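/- Let $\Sigma$ be a finite alphabet and let $\widetilde\Sigma=\Sigma\cup\{\text{¢},\$\}$, where ¢ and \$ are end-markers not in $\Sigma$. An input $w\in\Sigma^*$ is read, from left to right, as $\tilde w=\text{¢}\,w\,\$$. An affine finite automaton (AfA) $M=(E,\Sigma,\{A_\sigma\}_{\sigma\in\widetilde\Sigma},e_s,E_a)$ consists of a finite state set $E$, a starting state $e_s\in E$, a set $E_a\subseteq E$ of accepting states, and for each $\sigma\in\widetilde\Sigma$ a real $E\times E$ matrix $A_\sigma$ each of whose columns sums to $1$. Its final state on $w$ is $v_f=A_{\tilde w_{|\tilde w|}}\cdots A_{\tilde w_1}e_s\in\mathbb R^E$ (with $e_s$ identified with the corresponding standard basis vector), and its accepting value is $$f_M(w)=\sum_{e\in E_a}\frac{|v_f[e]|}{\sum_{e'\in E}|v_f[e']|}.$$ A quantum finite automaton (QFA) $M=(Q,\Sigma,\{\mathcal E_\sigma\}_{\sigma\in\widetilde\Sigma},q_s,Q_a)$ consists of a finite set $Q$ of basis states, a starting state $q_s\in Q$, a set $Q_a\subseteq Q$ of accepting states, and for each $\sigma\in\widetilde\Sigma$ a superoperator $\mathcal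 E_\sigma$, that is, a map $\rho\mapsto\sum_{j=1}^m E_j\rho E_j^\dagger$ given by finitely many complex $Q\times Q$ matrices $E_1,\dots,E_m$ ($m\ge 1$, depending on $\sigma$) with $\sum_{j=1}^m E_j^\dagger E_j=I$. Starting from $\rho_0=|q_s\rangle\langle q_s|$, put $\rho_j=\mathcal E_{\tilde w_j}(\rho_{j-1})$ and $\rho_f=\rho_{|\tilde w|}$; the accepting probability is $f_M(w)=\sum_{q\in Q_a}\rho_f[q,q]$. A language $L\subseteq\Sigma^*$ is recognized by $M$ with cutpoint $0$ if $L=\{w\in\Sigma^*: f_M(w)>0\}$. Let $\mathsf{NAfL}$ be the class of languages recognized by some AfA with cutpoint $0$, and $\mathsf{NQAL}$ the class of languages recognized by some QFA with cutpoint $0$. **Theorem.** $\mathsf{NAfL}=\mathsf{NQAL}$; that is, over every finite alphabet $\Sigma$, a language is recognized by an AfA with cutpoint $0$ if and only if it is recognized by a QFA with cutpoint $0$. -/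

import Mathlib

section

open scoped Matrix

/-- The extended alphabet: the letters of the input alphabet together with the left and the
right end-marker. -/
inductive TapeSymbol (α : Type*) where
  | leftEnd : TapeSymbol α
  | letter (a : α) : TapeSymbol α
  | rightEnd : TapeSymbol α

/-- The input `w` enclosed between the two end-markers. -/
def tapeWord {α : Type*} (w : List α) : List (TapeSymbol α) :=
  TapeSymbol.leftEnd :: (w.map TapeSymbol.letter ++ [TapeSymbol.rightEnd])

/-- A square real matrix is an affine operator if the entries of each column sum to one. -/
def IsAffineMatrix {σ : Type*} [Fintype σ] (A : Matrix σ σ ℝ) : Prop :=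
  ∀ k, ∑ j, A j k = 1

/-- An affine finite automaton over the alphabet `α` with finite state set `σ`. -/
structure AfA (α : Type*) (σ : Type*) [Fintype σ] where
  /-- The transition matrix of each symbol; `trans a j k` is the transition value from the
  state `k` to the state `j`. -/
  trans : TapeSymbol α → Matrix σ σ ℝ
  trans_affine : ∀ a, IsAffineMatrix (trans a)
  start : σ
  accept : Finset σ

namespace AfA

variable {α : Type*} {σ : Type*} [Fintype σ] [DecidableEq σ]

/-- The affine state reached from the starting state after reading a string over the extended
alphabet from left to right. -/
def stateAfter (M : AfA α σ) (x : List (TapeSymbol α)) : σ → ℝ :=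
  x.foldl (fun v a => M.trans a *ᵥ v) (Pi.single M.start 1)

/-- The affine state after reading the whole input, end-markers included. -/
def finalState (M : AfA α σ) (w : List α) : σ → ℝ :=
  M.stateAfter (tapeWord w)

/-- The accepting value of `M` on `w`: the total weight of the accepting states in the final
affine state. The entries of the final state sum to one, so the denominator is at least one. -/
noncomputable def acceptValue (M : AfA α σ) (w : List α) : ℝ :=
  ∑ k ∈ M.accept, |M.finalState w k| / ∑ j, |M.finalState w j|

end AfA

/-- A superoperator on the Hilbert space with standard basis `σ`, given by a finite, nonempty
family of operation elements. -/
structure Superoperator (σ : Type*) [Fintype σ] [DecidableEq σ] where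
  m : ℕ
  m_pos : 0 < m
  elem : Fin m → Matrix σ σ ℂ
  sum_eq_one : ∑ j, (elem j)ᴴ * elem j = 1

/-- The action of a superoperator on a mixed state. -/
def Superoperator.apply {σ : Type*} [Fintype σ] [DecidableEq σ] (S : Superoperator σ)
    (ρ : Matrix σ σ ℂ) : Matrix σ σ ℂ :=
  ∑ j, S.elem j * ρ * (S.elem j)ᴴ

/-- A quantum finite automaton over the alphabet `α` with finite set `σ` of basis states. -/
structure QFA (α : Type*) (σ : Type*) [Fintype σ] [DecidableEq σ] where
  trans : TapeSymbol α → Superoperator σ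
  start : σ
  accept : Finset σ

namespace QFA

variable {α : Type*} {σ : Type*} [Fintype σ] [DecidableEq σ]

/-- The mixed state reached from the starting basis state (as a density matrix) after reading
a string over the extended alphabet from left to right. -/
def stateAfter (M : QFA α σ) (x : List (TapeSymbol α)) : Matrix σ σ ℂ :=
  x.foldl (fun ρ a => (M.trans a).apply ρ) (Matrix.single M.start M.start 1)

/-- The mixed state after reading the whole input, end-markers included. -/
def finalState (M : QFA α σ) (w : List α) : Matrix σ σ ℂ :=
  M.stateAfter (tapeWord w)

/-- The accepting probability of `M` on `w`. The final state is positive semidefinite, so its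
diagonal entries are nonnegative real numbers and taking real parts loses nothing. -/
def acceptProb (M : QFA α σ) (w : List α) : ℝ :=
  ∑ j ∈ M.accept, (M.finalState w j j).re

end QFA

/-- `L` is recognized with cutpoint `c` by a machine whose accepting value on `w` is `f w`. -/
def RecognizedWithCutpoint {α : Type*} (f : List α → ℝ) (c : ℝ) (L : Language α) : Prop :=
  ∀ w, w ∈ L ↔ c < f w

/-- The nondeterministic affine languages over `α`: the languages recognized by an affine finite
automaton with cutpoint `0`. -/
def NAfL (α : Type*) : Set (Language α) :=
  {L | ∃ (σ : Type) (_ : Fintype σ) (_ : DecidableEq σ) (M : AfA α σ),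
    RecognizedWithCutpoint M.acceptValue 0 L}

/-- The nondeterministic quantum automaton languages over `α`: the languages recognized by a
quantum finite automaton with cutpoint `0`. -/
def NQAL (α : Type*) : Set (Language α) :=
  {L | ∃ (σ : Type) (_ : Fintype σ) (_ : DecidableEq σ) (M : QFA α σ),
    RecognizedWithCutpoint M.acceptProb 0 L}

end

/-! With cutpoint `0` only the vanishing of the accepting coordinates matters, so positive rescaling
and additional rejecting states are harmless. From affine to quantum, the vector `v` is encoded as
the unnormalized pure state `v vᵀ`. Each transition matrix is shrunk to a contraction, and the
missing trace is sent to a rejecting sink (`exists_apply_eq_smul_of_ne`). Off the sink the state is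
`r v vᵀ` with `r > 0`, and its diagonal entries `r v_k²` vanish exactly when `v_k` does. From
quantum to affine, superoperators are real-linear in the density matrix. Their matrices in real
coordinates become affine with one more state that corrects the column sums. Diagonal entries of a
density matrix are nonnegative, so the accepting probability is positive iff one of them is nonzero.
-/

section

open scoped Matrix

/-! ### Superoperators realizing a given matrix up to scale -/

namespace Superoperator

variable {σ : Type*} [Fintype σ] [DecidableEq σ]

/-- A superoperator whose operation elements are indexed by an arbitrary nonempty finite type. -/
noncomputable def ofFintype {ι : Type*} [Fintype ι] [Nonempty ι] (E : ι → Matrix σ σ ℂ)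
    (hE : ∑ j, (E j)ᴴ * E j = 1) : Superoperator σ where
  m := Fintype.card ι
  m_pos := Fintype.card_pos
  elem j := E ((Fintype.equivFin ι).symm j)
  sum_eq_one := by
    rw [← hE]
    exact Equiv.sum_comp (Fintype.equivFin ι).symm fun j => (E j)ᴴ * E j

lemma ofFintype_apply {ι : Type*} [Fintype ι] [Nonempty ι] (E : ι → Matrix σ σ ℂ)
    (hE : ∑ j, (E j)ᴴ * E j = 1) (ρ : Matrix σ σ ℂ) :
    (ofFintype E hE).apply ρ = ∑ j, E j * ρ * (E j)ᴴ :=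
  Equiv.sum_comp (Fintype.equivFin ι).symm fun j => E j * ρ * (E j)ᴴ

/-- The action of a superoperator as a real-linear map. -/
def toLinearMap (S : Superoperator σ) : Matrix σ σ ℂ →ₗ[ℝ] Matrix σ σ ℂ where
  toFun := S.apply
  map_add' ρ τ := by
    simp only [apply, Matrix.mul_add, Matrix.add_mul, Finset.sum_add_distrib]
  map_smul' c ρ := by
    simp only [apply, Matrix.mul_smul, Matrix.smul_mul, Finset.smul_sum, RingHom.id_apply]

open scoped ComplexOrder in
lemma posSemidef_apply (S : Superoperator σ) {ρ : Matrix σ σ ℂ} (hρ : ρ.PosSemidef) :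
    (S.apply ρ).PosSemidef :=
  Matrix.posSemidef_sum _ fun j _ => hρ.mul_mul_conjTranspose_same (S.elem j)

open scoped MatrixOrder Matrix.Norms.L2Operator in
/-- Every square matrix can be rescaled to a contraction and then completed to an isometry. -/
lemma exists_smul_conjTranspose_mul_add_eq_one (A : Matrix σ σ ℂ) :
    ∃ c : ℝ, 0 < c ∧ ∃ B : Matrix σ σ ℂ,
      ((c : ℂ) • A)ᴴ * ((c : ℂ) • A) + Bᴴ * B = 1 := by
  -- The summand `1` keeps the scaling factor defined when `A = 0`.
  have hpos : 0 < ‖A‖ + 1 := by positivity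
  refine ⟨(‖A‖ + 1)⁻¹, inv_pos.mpr hpos, ?_⟩
  set C : Matrix σ σ ℂ := (((‖A‖ + 1)⁻¹ : ℝ) : ℂ) • A with hC
  have hnorm : ‖star C * C‖ ≤ 1 := by
    have h : ‖C‖ ≤ 1 := by
      rw [hC, norm_smul, Complex.norm_real, Real.norm_of_nonneg (inv_pos.mpr hpos).le,
        inv_mul_le_one₀ hpos]
      linarith
    rw [CStarRing.norm_star_mul_self]
    exact mul_le_one₀ h (norm_nonneg _) h
  have hle : star C * C ≤ 1 := by
    have h1 : star C * C ≤ algebraMap ℝ _ ‖star C * C‖ :=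
      (IsSelfAdjoint.star_mul_self C).le_algebraMap_norm_self
    have h2 : algebraMap ℝ (Matrix σ σ ℂ) ‖star C * C‖ ≤ algebraMap ℝ _ 1 :=
      algebraMap_mono _ hnorm
    rw [map_one] at h2
    exact h1.trans h2
  obtain ⟨B, hB⟩ := CStarAlgebra.nonneg_iff_eq_star_mul_self.mp (sub_nonneg.mpr hle)
  exact ⟨B, by
    rw [← Matrix.star_eq_conjTranspose, ← Matrix.star_eq_conjTranspose, ← hB, add_sub_cancel]⟩

/-- Away from a sink state `s`, every matrix is implemented by a superoperator, up to a positive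
factor. -/
lemma exists_apply_eq_smul_of_ne (A : Matrix σ σ ℂ) (s : σ) :
    ∃ S : Superoperator σ, ∃ r : ℝ, 0 < r ∧
      ∀ ρ i j, i ≠ s → S.apply ρ i j = r * (A * ρ * Aᴴ) i j := by
  obtain ⟨c, hc, B, hB⟩ := exists_smul_conjTranspose_mul_add_eq_one A
  -- The elements `|s⟩⟨q| B` together contribute `Bᴴ * B`, because the projections `|q⟩⟨q|` sum to
  -- `1`, and they write only into row `s`.
  let E : Option σ → Matrix σ σ ℂ := fun o =>
    o.elim ((c : ℂ) • A) fun q => Matrix.single s q 1 * B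
  have hE : ∑ o, (E o)ᴴ * E o = 1 := by
    have h : ∀ q, (Matrix.single s q (1 : ℂ) * B)ᴴ * (Matrix.single s q 1 * B)
        = Bᴴ * Matrix.single q q 1 * B := fun q => by
      rw [Matrix.conjTranspose_mul, Matrix.conjTranspose_single, star_one, Matrix.mul_assoc,
        ← Matrix.mul_assoc (Matrix.single q s 1), Matrix.single_mul_single_same, mul_one,
        ← Matrix.mul_assoc]
    have hsum : ∑ q : σ, Matrix.single q q (1 : ℂ) = 1 := by
      ext i j
      simp [Matrix.sum_apply, Matrix.single_apply, Matrix.one_apply, ite_and]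
    rw [Fintype.sum_option]
    simp only [E, Option.elim, h]
    rw [← Finset.sum_mul, ← Finset.mul_sum, hsum, mul_one, hB]
  refine ⟨ofFintype E hE, c ^ 2, by positivity, fun ρ i j hi => ?_⟩
  have h0 : ∀ q, (Matrix.single s q (1 : ℂ) * B * ρ * (Matrix.single s q 1 * B)ᴴ : Matrix σ σ ℂ)
      i j = 0 := fun q => by
    rw [Matrix.mul_assoc, Matrix.mul_assoc, Matrix.single_mul_apply_of_ne _ _ _ _ _ hi]
  rw [ofFintype_apply, Fintype.sum_option]
  simp only [E, Option.elim, Matrix.add_apply, Matrix.sum_apply, h0, Finset.sum_const_zero,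
    add_zero]
  simp [pow_two, mul_assoc]

end Superoperator

/-! ### From affine to quantum automata -/

namespace AfA

variable {α : Type*} {σ : Type*} [Fintype σ]

/-- A real matrix as a complex matrix with an additional zero row and a zero column. -/
def sinkMatrix (A : Matrix σ σ ℝ) : Matrix (Option σ) (Option σ) ℂ :=
  fun i j => i.elim 0 fun i => j.elim 0 fun j => (A i j : ℂ)

/-- The zero column discards every entry of `ρ` in the sink's row or column, so nothing need be
known about them. -/
lemma sinkMatrix_conj_apply (A : Matrix σ σ ℝ) (v : σ → ℝ) {r : ℝ}
    {ρ : Matrix (Option σ) (Option σ) ℂ}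
    (hρ : ∀ i j, ρ (some i) (some j) = r * (v i * v j)) (i j : σ) :
    (sinkMatrix A * ρ * (sinkMatrix A)ᴴ) (some i) (some j)
      = r * ((A *ᵥ v) i * (A *ᵥ v) j : ℝ) := by
  have hl : (sinkMatrix A * ρ * (sinkMatrix A)ᴴ) (some i) (some j)
      = ∑ l, ∑ k, (A i k : ℂ) * (r * (v k * v l)) * A j l := by
    simp only [Matrix.mul_apply, Fintype.sum_option, Matrix.conjTranspose_apply, sinkMatrix,
      Option.elim, hρ, map_zero, Finset.sum_const_zero, mul_zero, zero_mul, zero_add,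
      Finset.sum_mul, Complex.star_def, Complex.conj_ofReal]
  have hr : ((A *ᵥ v) i * (A *ᵥ v) j : ℝ) = ∑ l, ∑ k, A i k * v k * (A j l * v l) := by
    rw [Finset.sum_comm, Matrix.mulVec, Matrix.mulVec, dotProduct, dotProduct, Finset.sum_mul_sum]
  rw [hl, hr]
  push_cast
  simp only [Finset.mul_sum]
  exact Finset.sum_congr rfl fun l _ => Finset.sum_congr rfl fun k _ => by ring

/-- Completion of a real matrix to an affine one by an additional state. -/
def affineCompletion (A : Matrix σ σ ℝ) : Matrix (Option σ) (Option σ) ℝ :=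
  fun i j => i.elim (j.elim 1 fun j => 1 - ∑ k, A k j) fun i => j.elim 0 fun j => A i j

lemma isAffineMatrix_affineCompletion (A : Matrix σ σ ℝ) :
    IsAffineMatrix (affineCompletion A) := by
  rintro (_ | j) <;> simp [affineCompletion, Fintype.sum_option]

/-- The added state feeds only into itself, so correcting the column sums leaves the original
dynamics intact. -/
lemma affineCompletion_mulVec_some (A : Matrix σ σ ℝ) (v : Option σ → ℝ) (i : σ) :
    (affineCompletion A *ᵥ v) (some i) = (A *ᵥ fun k => v (some k)) i := by
  simp [Matrix.mulVec, dotProduct, affineCompletion, Fintype.sum_option]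

variable [DecidableEq σ]

lemma acceptValue_pos_iff (M : AfA α σ) (w : List α) :
    0 < M.acceptValue w ↔ ∃ k ∈ M.accept, M.finalState w k ≠ 0 := by
  have hnonneg : ∀ k ∈ M.accept, 0 ≤ |M.finalState w k| / ∑ j, |M.finalState w j| :=
    fun k _ => by positivity
  rw [acceptValue, Finset.sum_pos_iff_of_nonneg hnonneg]
  refine exists_congr fun k => and_congr_right fun _ => ⟨fun h h0 => by simp [h0] at h, fun h => ?_⟩
  have hk : 0 < |M.finalState w k| := abs_pos.mpr h
  exact div_pos hk (hk.trans_le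
    (Finset.single_le_sum (f := fun j => |M.finalState w j|) (fun j _ => abs_nonneg _)
      (Finset.mem_univ k)))

/-- A quantum automaton simulating an affine one on pure states, up to rescaling and an additional
rejecting state. -/
noncomputable def toQFA (M : AfA α σ) : QFA α (Option σ) where
  trans a := (Superoperator.exists_apply_eq_smul_of_ne (sinkMatrix (M.trans a)) none).choose
  start := some M.start
  accept := M.accept.map Function.Embedding.some

lemma exists_toQFA_stateAfter_eq (M : AfA α σ) (x : List (TapeSymbol α)) :
    ∃ r : ℝ, 0 < r ∧ ∀ i j, M.toQFA.stateAfter x (some i) (some j)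
      = r * (M.stateAfter x i * M.stateAfter x j) := by
  induction x using List.reverseRecOn with
  | nil =>
    refine ⟨1, one_pos, fun i j => ?_⟩
    by_cases hi : i = M.start <;> by_cases hj : j = M.start <;>
      simp [QFA.stateAfter, stateAfter, toQFA, hi, hj, Ne.symm]
  | append_singleton x a ih =>
    obtain ⟨r, hr, h⟩ := ih
    obtain ⟨c, hc, hS⟩ :=
      (Superoperator.exists_apply_eq_smul_of_ne (sinkMatrix (M.trans a)) none).choose_spec
    refine ⟨c * r, mul_pos hc hr, fun i j => ?_⟩
    have key := hS (M.toQFA.stateAfter x) (some i) (some j) (Option.some_ne_none i)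
    rw [sinkMatrix_conj_apply _ _ h] at key
    simp only [QFA.stateAfter, stateAfter, List.foldl_append, List.foldl_cons,
      List.foldl_nil] at key ⊢
    refine key.trans ?_
    push_cast
    ring

lemma toQFA_acceptProb_pos_iff (M : AfA α σ) (w : List α) :
    0 < M.toQFA.acceptProb w ↔ 0 < M.acceptValue w := by
  obtain ⟨r, hr, h⟩ := M.exists_toQFA_stateAfter_eq (tapeWord w)
  have hre : ∀ k, (M.toQFA.finalState w (some k) (some k)).re
      = r * (M.finalState w k * M.finalState w k) := fun k => by
    rw [QFA.finalState, h]
    norm_cast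
  have hprob : M.toQFA.acceptProb w
      = ∑ k ∈ M.accept, r * (M.finalState w k * M.finalState w k) := by
    rw [QFA.acceptProb]
    simp only [show M.toQFA.accept = M.accept.map Function.Embedding.some from rfl,
      Finset.sum_map, Function.Embedding.some_apply, hre]
  rw [hprob, acceptValue_pos_iff,
    Finset.sum_pos_iff_of_nonneg fun k _ => mul_nonneg hr.le (mul_self_nonneg _)]
  refine exists_congr fun k => and_congr_right fun _ => ?_
  rw [mul_pos_iff_of_pos_left hr, mul_self_pos]

end AfA

/-! ### From quantum to affine automata -/

namespace QFA

variable {α : Type*} {σ : Type*} [Fintype σ]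

variable (σ) in
/-- The real and imaginary parts of matrix entries as coordinates. -/
noncomputable def realBasis : Module.Basis (Fin 2 × σ × σ) ℝ (Matrix σ σ ℂ) :=
  Complex.basisOneI.smulTower (Matrix.stdBasis ℂ σ σ)

lemma realBasis_repr_zero (ρ : Matrix σ σ ℂ) (i j : σ) :
    (realBasis σ).repr ρ (0, i, j) = (ρ i j).re := by
  have h : (Matrix.stdBasis ℂ σ σ).repr ρ (i, j) = ρ i j := by
    simp [Matrix.stdBasis]
  rw [realBasis, Module.Basis.smulTower_repr_mk, h]
  simp

variable [DecidableEq σ]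

open scoped ComplexOrder in
lemma posSemidef_stateAfter (M : QFA α σ) (x : List (TapeSymbol α)) :
    (M.stateAfter x).PosSemidef := by
  induction x using List.reverseRecOn with
  | nil =>
    have h := Matrix.posSemidef_self_mul_conjTranspose
      (Matrix.single M.start M.start (1 : ℂ))
    simpa [stateAfter] using h
  | append_singleton x a ih =>
    simpa only [stateAfter, List.foldl_append, List.foldl_cons, List.foldl_nil] using
      (M.trans a).posSemidef_apply ih

open scoped ComplexOrder in
-- Positive semidefiniteness excludes cancellation among the accepting diagonal entries.
lemma acceptProb_pos_iff (M : QFA α σ) (w : List α) :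
    0 < M.acceptProb w ↔ ∃ k ∈ M.accept, (M.finalState w k k).re ≠ 0 := by
  have hnonneg : ∀ k, 0 ≤ (M.finalState w k k).re := fun k =>
    (Complex.le_def.mp (M.posSemidef_stateAfter (tapeWord w)).diag_nonneg).1
  rw [acceptProb, Finset.sum_pos_iff_of_nonneg fun k _ => hnonneg k]
  exact exists_congr fun k => and_congr_right fun _ => (hnonneg k).lt_iff_ne'

/-- Makes the initial density matrix a basis vector, as the start of an affine automaton must be. -/
lemma realBasis_zero (i j : σ) : realBasis σ (0, i, j) = Matrix.single i j 1 := by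
  rw [realBasis, Module.Basis.smulTower_apply, Matrix.stdBasis_eq_single]
  simp

/-- An affine automaton whose state lists the real coordinates of the density matrix of a quantum
automaton, with one additional rejecting state. -/
noncomputable def toAfA (M : QFA α σ) : AfA α (Option (Fin 2 × σ × σ)) where
  trans a := AfA.affineCompletion
    (LinearMap.toMatrix (realBasis σ) (realBasis σ) (M.trans a).toLinearMap)
  trans_affine _ := AfA.isAffineMatrix_affineCompletion _
  start := some (0, M.start, M.start)
  accept := M.accept.image fun k => some (0, k, k)

lemma toAfA_stateAfter_some (M : QFA α σ) (x : List (TapeSymbol α)) :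
    (fun p => M.toAfA.stateAfter x (some p)) = (realBasis σ).repr (M.stateAfter x) := by
  induction x using List.reverseRecOn with
  | nil =>
    ext p
    simp only [AfA.stateAfter, stateAfter, toAfA, List.foldl_nil]
    rw [← realBasis_zero, Module.Basis.repr_self, Finsupp.single_apply, Pi.single_apply]
    simp only [Option.some.injEq, eq_comm]
  | append_singleton x a ih =>
    have h : M.stateAfter (x ++ [a]) = (M.trans a).toLinearMap (M.stateAfter x) := by
      simp only [stateAfter, List.foldl_append, List.foldl_cons, List.foldl_nil]
      rfl
    rw [h, ← LinearMap.toMatrix_mulVec_repr (realBasis σ), ← ih]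
    ext p
    rw [← AfA.affineCompletion_mulVec_some]
    simp [AfA.stateAfter, toAfA]

lemma toAfA_acceptValue_pos_iff (M : QFA α σ) (w : List α) :
    0 < M.toAfA.acceptValue w ↔ 0 < M.acceptProb w := by
  have h : ∀ k, M.toAfA.finalState w (some (0, k, k)) = (M.finalState w k k).re := fun k =>
    (congrFun (M.toAfA_stateAfter_some (tapeWord w)) (0, k, k)).trans
      (realBasis_repr_zero _ k k)
  rw [acceptProb_pos_iff, AfA.acceptValue_pos_iff]
  simp only [show M.toAfA.accept = M.accept.image fun k => some (0, k, k) from rfl,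
    Finset.mem_image, exists_exists_and_eq_and, h]

end QFA

end

theorem mainTheorem1 (α : Type*) [Finite α] : NAfL α = NQAL α := by
  ext L
  constructor
  · rintro ⟨σ, _, _, M, hM⟩
    exact ⟨Option σ, inferInstance, inferInstance, M.toQFA, fun w =>
      (hM w).trans (M.toQFA_acceptProb_pos_iff w).symm⟩
  · rintro ⟨σ, _, _, M, hM⟩
    exact ⟨Option (Fin 2 × σ × σ), inferInstance, inferInstance, M.toAfA, fun w =>
      (hM w).trans (M.toAfA_acceptValue_pos_iff w).symm⟩
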